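/- Let $X$ be a second-countable, locally compact Hausdorff space and $\mathfrak M^+$ the cone of positive Radon measures on $X$. Let $\kappa:X\times X\to[0,\infty]$ be a symmetric, lower semicontinuous kernel. Put $U^\mu(x)=\int\kappa(x,y)\,d\mu(y)$, $I(\mu,\nu)=\int\kappa\,d(\mu\otimes\nu)$ and $I(\mu)=I(\mu,\mu)$. Let $\mathcal E^+$ be the set of $\mu\in\mathfrak M^+$ with $I(\mu)<\infty$, and for $A\subset X$ let $\mathcal E^+(A)$ be the set of $\mu\in\mathcal E^+$ with $\mu(X\setminus A)=0$ and $\breve{\mathcal E}^+(A)=\{\mu\in\mathcal E^+(A):\mu(X)=1\}$. The inner capacity is $c_*(A)=1/\inf\{I(\mu):\mu\in\breve{\mathcal E}^+(A)\}$ (with $\inf\varnothing=\infty$), and "n.e. on $A$" means outside a subset of $A$ of inner capacity zero. Assume that $\kappa$ satisfies the following principles. - Energy principle: $I(\sigma)\ge0$ for every signed Radon measure $\sigma$ whose energy $I(\sigma)=I(\sigma,\sigma)$ is well defined, with $I(\sigma)=0$ only for $\sigma=0$. Write $\|\mu-\nu\|=\sqrt{I(\mu-\nu)}$ for the resulting (strong)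 distance. - Consistency principle: $\mathcal E^+$ is strongly complete, and the strong topology on $\mathcal E^+$ is finer than the vague topology. - Domination principle: if $\mu\in\mathcal E^+$, $\nu\in\mathfrak M^+$ and $U^\mu\le U^\nu$ $\mu$-a.e., then $U^\mu\le U^\nu$ on $X$. - Frostman's maximum principle: if $\mu\in\mathcal E^+$ and $U^\mu\le c$ $\mu$-a.e. for some $c\in(0,\infty)$, then $U^\mu\le c$ on $X$. Let $A\subset X$ be such that $c_*(A)>0$ and $\mathcal E^+(A)$ is strongly closed. Let $\omega\in\mathfrak M^+$, $\omega\neq0$, be such that either $\omega\in\mathcal E^+$, or $\omega(X)<\infty$, $U^\omega|_K$ is upper semicontinuous for every compact $K\subset A$, and $\sup_A U^\omega<\infty$. Put $f=-U^\omega$. Then there is exactly one measure $\omega^A\in\mathcal E^+(A)$ with $U^{\omega^A}=U^\omega$ n.e. on $A$ (the inner balayage of $\omega$ onto $A$). Moreover, assume that the inner Gauss variational problem is solvable, i.e. that there is $\lambda_{A,f}\in\breve{\mathcal E}^+(A)$ minimizing $I_f(\mu)=I(\mu)-2\int U^\omega\,d\mu$ over $\mu\in\breve{\mathcal E}^+(A)$.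 Then the inner $f$-weighted equilibrium constant $$c_{A,f}=\int\bigl(U^{\lambda_{A,f}}-U^\omega\bigr)\,d\lambda_{A,f}$$ is well defined and finite (both potentials are finite $\lambda_{A,f}$-a.e. and their difference is $\lambda_{A,f}$-integrable), and $$c_{A,f}<0\ \text{ if }\omega^A(X)>1,\qquad c_{A,f}=0\ \text{ if }\omega^A(X)=1,\qquad c_{A,f}>0\ \text{ if }\omega^A(X)<1.$$ -/

import Mathlib

open MeasureTheory Set Filter Topology
open scoped ENNReal NNReal

namespace Balayage

variable {X : Type*} [TopologicalSpace X] [MeasurableSpace X]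

/-- Positive Radon measures. On a second-countable locally compact Hausdorff space these are exactly
the Borel measures that are finite on compact sets. -/
def Radon (X : Type*) [TopologicalSpace X] [MeasurableSpace X] : Set (Measure X) :=
  {μ | IsFiniteMeasureOnCompacts μ}

/-- A kernel: a symmetric lower semicontinuous function with values in `[0,∞]`. -/
structure IsKernel (κ : X × X → ℝ≥0∞) : Prop where
  symm : ∀ x y, κ (x, y) = κ (y, x)
  lsc : LowerSemicontinuous κ

/-- The potential `U^μ` of a positive measure. -/
noncomputable def potential (κ : X × X → ℝ≥0∞) (μ : Measure X) (x : X) : ℝ≥0∞ :=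
  ∫⁻ y, κ (x, y) ∂μ

/-- The mutual energy `I(μ, ν)` of two positive measures. The energy of `μ` is `energy κ μ μ`. -/
noncomputable def energy (κ : X × X → ℝ≥0∞) (μ ν : Measure X) : ℝ≥0∞ :=
  ∫⁻ p, κ p ∂(μ.prod ν)

/-- The energy principle (strict positive definiteness). A signed Radon measure `σ` is given by its
Jordan decomposition, a pair of mutually singular positive Radon measures `σ⁺, σ⁻`. Its energy is
`I(σ) = (I(σ⁺,σ⁺) + I(σ⁻,σ⁻)) - 2 I(σ⁺,σ⁻)`, which is well defined as a finite number or `±∞` if and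
only if the two terms are not both infinite. The principle says that then `I(σ) ≥ 0`, and that
`I(σ) = 0` only for `σ = 0`. -/
def EnergyPrinciple (κ : X × X → ℝ≥0∞) : Prop :=
  ∀ σp ∈ Radon X, ∀ σm ∈ Radon X, σp ⟂ₘ σm →
    (energy κ σp σp + energy κ σm σm < ∞ ∨ 2 * energy κ σp σm < ∞) →
    2 * energy κ σp σm ≤ energy κ σp σp + energy κ σm σm ∧
    (2 * energy κ σp σm = energy κ σp σp + energy κ σm σm → σp = 0 ∧ σm = 0)

/-- The cone `ℰ⁺` of positive Radon measures of finite energy. -/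
def EPlus (κ : X × X → ℝ≥0∞) : Set (Measure X) :=
  {μ | μ ∈ Radon X ∧ energy κ μ μ < ∞}

/-- The cone `ℰ⁺(A)` of the measures in `ℰ⁺` that are concentrated on `A`. -/
def EPlusOn (κ : X × X → ℝ≥0∞) (A : Set X) : Set (Measure X) :=
  {μ | μ ∈ EPlus κ ∧ μ Aᶜ = 0}

/-- The measures of total mass one in `ℰ⁺(A)`. -/
def EPlusUnitOn (κ : X × X → ℝ≥0∞) (A : Set X) : Set (Measure X) :=
  {μ | μ ∈ EPlusOn κ A ∧ μ univ = 1}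

/-- The strong distance `‖μ - ν‖ = √(I(μ,μ) + I(ν,ν) - 2 I(μ,ν))` between elements of `ℰ⁺`
(all three energies are finite there, by the energy principle). -/
noncomputable def strongDist (κ : X × X → ℝ≥0∞) (μ ν : Measure X) : ℝ :=
  √((energy κ μ μ).toReal + (energy κ ν ν).toReal - 2 * (energy κ μ ν).toReal)

/-- The consistency principle: `ℰ⁺` is complete in the strong topology, and the strong topology on
`ℰ⁺` is finer than the vague one (`μ ↦ ∫ φ dμ` is strongly continuous on `ℰ⁺` for every continuous
`φ` of compact support). -/
structure ConsistencyPrinciple (κ : X × X → ℝ≥0∞) : Prop where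
  complete : ∀ u : ℕ → Measure X, (∀ n, u n ∈ EPlus κ) →
    (∀ ε > 0, ∃ N, ∀ m ≥ N, ∀ n ≥ N, strongDist κ (u m) (u n) < ε) →
    ∃ μ ∈ EPlus κ, Tendsto (fun n => strongDist κ (u n) μ) atTop (𝓝 0)
  finer : ∀ μ₀ ∈ EPlus κ, ∀ φ : X → ℝ, Continuous φ → HasCompactSupport φ →
    ∀ ε > 0, ∃ δ > 0, ∀ μ ∈ EPlus κ, strongDist κ μ μ₀ < δ →
      |∫ x, φ x ∂μ - ∫ x, φ x ∂μ₀| < ε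

/-- The domination principle. -/
def DominationPrinciple (κ : X × X → ℝ≥0∞) : Prop :=
  ∀ μ ∈ EPlus κ, ∀ ν ∈ Radon X, (∀ᵐ x ∂μ, potential κ μ x ≤ potential κ ν x) →
    ∀ x, potential κ μ x ≤ potential κ ν x

/-- Frostman's maximum principle (Ugaheri's maximum principle with constant `1`). -/
def FrostmanPrinciple (κ : X × X → ℝ≥0∞) : Prop :=
  ∀ μ ∈ EPlus κ, ∀ c : ℝ≥0, 0 < c → (∀ᵐ x ∂μ, potential κ μ x ≤ c) →
    ∀ x, potential κ μ x ≤ c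

/-- The cone `ℰ⁺(A)` is closed in the strong topology (a strong limit of elements of `ℰ⁺` always
lies in `ℰ⁺`, because `ℰ⁺` is strongly complete). -/
def StronglyClosed (κ : X × X → ℝ≥0∞) (A : Set X) : Prop :=
  ∀ u : ℕ → Measure X, (∀ n, u n ∈ EPlusOn κ A) → ∀ μ ∈ EPlus κ,
    Tendsto (fun n => strongDist κ (u n) μ) atTop (𝓝 0) → μ ∈ EPlusOn κ A

/-- The inner capacity `c_*(A) = 1 / inf I(μ)`, the infimum being over all `μ` of mass one in
`ℰ⁺(A)` (with `inf ∅ = ∞`, `1/∞ = 0` and `1/0 = ∞`). -/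
noncomputable def innerCapacity (κ : X × X → ℝ≥0∞) (A : Set X) : ℝ≥0∞ :=
  (⨅ μ ∈ EPlusUnitOn κ A, energy κ μ μ)⁻¹

/-- `P` holds nearly everywhere on `A`. -/
def NearlyEverywhereOn (κ : X × X → ℝ≥0∞) (A : Set X) (P : X → Prop) : Prop :=
  innerCapacity κ {x ∈ A | ¬ P x} = 0

/-- The standing assumptions on `ω`: a nonzero positive Radon measure which either has finite energy,
or is bounded with a potential that is upper semicontinuous on each compact subset of `A` and
bounded on `A`. -/
structure Admissible (κ : X × X → ℝ≥0∞) (A : Set X) (ω : Measure X) : Prop where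
  radon : ω ∈ Radon X
  ne_zero : ω ≠ 0
  cases : ω ∈ EPlus κ ∨
    (ω univ < ∞ ∧
      (∀ K : Set X, IsCompact K → K ⊆ A → UpperSemicontinuousOn (potential κ ω) K) ∧
      (⨆ x ∈ A, potential κ ω x) < ∞)

/-- `ν` is the inner balayage of `ω` onto `A`: `ν ∈ ℰ⁺(A)` and `U^ν = U^ω` n.e. on `A`. -/
def IsInnerBalayage (κ : X × X → ℝ≥0∞) (A : Set X) (ω ν : Measure X) : Prop :=
  ν ∈ EPlusOn κ A ∧ NearlyEverywhereOn κ A (fun x => potential κ ν x = potential κ ω x)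

/-- The Gauss functional `I_f(μ) = ‖μ‖² + 2 ∫ f dμ` for the external field `f = -U^ω`. For admissible
`ω` both terms are finite whenever `μ` has mass one and belongs to `ℰ⁺(A)`. -/
noncomputable def gauss (κ : X × X → ℝ≥0∞) (ω μ : Measure X) : ℝ :=
  (energy κ μ μ).toReal - 2 * (∫⁻ x, potential κ ω x ∂μ).toReal

/-- `lam` solves the inner Gauss variational problem: it minimizes `I_f` over the measures of mass one
in `ℰ⁺(A)`. -/
def IsGaussMinimizer (κ : X × X → ℝ≥0∞) (A : Set X) (ω lam : Measure X) : Prop :=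
  lam ∈ EPlusUnitOn κ A ∧ ∀ μ ∈ EPlusUnitOn κ A, gauss κ ω lam ≤ gauss κ ω μ

/-- The weighted potential `U_f^μ = U^μ + f = U^μ - U^ω` (meaningful where both are finite). -/
noncomputable def weightedPotential (κ : X × X → ℝ≥0∞) (ω μ : Measure X) (x : X) : ℝ :=
  (potential κ μ x).toReal - (potential κ ω x).toReal

/-- `∫ U_f^μ dμ`; for the solution `μ` of the Gauss problem on `A`, this is the inner `f`-weighted
equilibrium constant `c_{A,f}`. -/
noncomputable def weightedConstant (κ : X × X → ℝ≥0∞) (ω μ : Measure X) : ℝ :=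
  ∫ x, weightedPotential κ ω μ x ∂μ

end Balayage

set_option linter.unusedSectionVars false

namespace Balayage

variable {X : Type*} [TopologicalSpace X] [MeasurableSpace X] {κ : X × X → ℝ≥0∞}

theorem Radon.mono {μ ν : Measure X} (hν : ν ∈ Radon X) (h : μ ≤ ν) : μ ∈ Radon X :=
  ⟨fun _ hK => (h _).trans_lt (hν.lt_top_of_isCompact hK)⟩

theorem Radon.add {μ ν : Measure X} (hμ : μ ∈ Radon X) (hν : ν ∈ Radon X) : μ + ν ∈ Radon X :=
  ⟨fun _ hK => by
    rw [Measure.add_apply]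
    exact ENNReal.add_lt_top.2 ⟨hμ.lt_top_of_isCompact hK, hν.lt_top_of_isCompact hK⟩⟩

theorem Radon.smul {μ : Measure X} (c : ℝ≥0) (hμ : μ ∈ Radon X) : c • μ ∈ Radon X :=
  ⟨fun _ hK => by
    rw [Measure.smul_apply, ENNReal.smul_def, smul_eq_mul]
    exact ENNReal.mul_lt_top ENNReal.coe_lt_top (hμ.lt_top_of_isCompact hK)⟩

theorem Radon.zero : (0 : Measure X) ∈ Radon X := ⟨fun _ _ => by simp⟩

theorem potential_add (μ ν : Measure X) (x : X) :
    potential κ (μ + ν) x = potential κ μ x + potential κ ν x :=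
  lintegral_add_measure _ _ _

section Topological

variable [T2Space X] [LocallyCompactSpace X] [SecondCountableTopology X] [BorelSpace X]

theorem Radon.sigmaFinite {μ : Measure X} (hμ : μ ∈ Radon X) : SigmaFinite μ := by
  have : IsFiniteMeasureOnCompacts μ := hμ
  have : IsLocallyFiniteMeasure μ := isLocallyFiniteMeasure_of_isFiniteMeasureOnCompacts
  infer_instance

theorem Radon.regular {μ : Measure X} (hμ : μ ∈ Radon X) : μ.Regular := by
  have : IsFiniteMeasureOnCompacts μ := hμ
  have : IsLocallyFiniteMeasure μ := isLocallyFiniteMeasure_of_isFiniteMeasureOnCompacts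
  infer_instance

theorem IsKernel.measurable (hκ : IsKernel κ) : Measurable κ := hκ.lsc.measurable

theorem measurable_potential (hκ : IsKernel κ) {μ : Measure X} (hμ : μ ∈ Radon X) :
    Measurable (potential κ μ) := by
  have := Radon.sigmaFinite hμ
  exact hκ.measurable.lintegral_prod_right'

theorem energy_eq_lintegral (hκ : IsKernel κ) (μ : Measure X) {ν : Measure X} (hν : ν ∈ Radon X) :
    energy κ μ ν = ∫⁻ x, potential κ ν x ∂μ := by
  have := Radon.sigmaFinite hν
  exact lintegral_prod _ hκ.measurable.aemeasurable

theorem energy_comm (hκ : IsKernel κ) {μ ν : Measure X} (hμ : μ ∈ Radon X) (hν : ν ∈ Radon X) :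
    energy κ μ ν = energy κ ν μ := by
  have := Radon.sigmaFinite hν
  have := Radon.sigmaFinite hμ
  rw [energy_eq_lintegral hκ _ hμ]
  refine (lintegral_prod_symm _ hκ.measurable.aemeasurable).trans ?_
  exact lintegral_congr fun y => lintegral_congr fun x => hκ.symm _ _

theorem energy_add_left (hκ : IsKernel κ) (μ ν : Measure X) {ρ : Measure X} (hρ : ρ ∈ Radon X) :
    energy κ (μ + ν) ρ = energy κ μ ρ + energy κ ν ρ := by
  simp only [energy_eq_lintegral hκ _ hρ, lintegral_add_measure]

theorem energy_add_right (hκ : IsKernel κ) {μ ν : Measure X} (ρ : Measure X) (hμ : μ ∈ Radon X)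
    (hν : ν ∈ Radon X) : energy κ ρ (μ + ν) = energy κ ρ μ + energy κ ρ ν := by
  rw [energy_eq_lintegral hκ _ (Radon.add hμ hν), energy_eq_lintegral hκ _ hμ,
    energy_eq_lintegral hκ _ hν, ← lintegral_add_left (measurable_potential hκ hμ)]
  exact lintegral_congr fun x => potential_add _ _ _

theorem energy_smul_left (hκ : IsKernel κ) (c : ℝ≥0) (μ : Measure X) {ρ : Measure X}
    (hρ : ρ ∈ Radon X) : energy κ (c • μ) ρ = c * energy κ μ ρ := by
  rw [energy_eq_lintegral hκ _ hρ, energy_eq_lintegral hκ _ hρ, lintegral_smul_measure,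
    ENNReal.smul_def, smul_eq_mul]

theorem energy_smul_right (hκ : IsKernel κ) (c : ℝ≥0) {μ ρ : Measure X} (hμ : μ ∈ Radon X)
    (hρ : ρ ∈ Radon X) : energy κ ρ (c • μ) = c * energy κ ρ μ := by
  rw [energy_comm hκ hρ (Radon.smul c hμ), energy_smul_left hκ _ _ hρ, energy_comm hκ hρ hμ]

theorem energy_mono (hκ : IsKernel κ) {μ μ' ν ν' : Measure X} (hμ : μ ≤ μ') (hν : ν ≤ ν')
    (hν' : ν' ∈ Radon X) : energy κ μ ν ≤ energy κ μ' ν' := by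
  rw [energy_eq_lintegral hκ _ hν', energy_eq_lintegral hκ _ (Radon.mono hν' hν)]
  exact lintegral_mono' hμ fun x => lintegral_mono' hν fun _ => le_rfl

/-- The Jordan decomposition of the difference of two positive Radon measures. -/
theorem exists_jordan {μ ν : Measure X} (hμ : μ ∈ Radon X) (hν : ν ∈ Radon X) :
    ∃ p ∈ Radon X, ∃ q ∈ Radon X, ∃ m ∈ Radon X, μ = p + m ∧ ν = q + m ∧ p ⟂ₘ q := by
  have := Radon.sigmaFinite hν
  have := Radon.sigmaFinite hμ
  set ρ := μ + ν
  set f := μ.rnDeriv ρ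
  set g := ν.rnDeriv ρ
  have hf : Measurable f := Measure.measurable_rnDeriv _ _
  have hg : Measurable g := Measure.measurable_rnDeriv _ _
  have hμρ : ρ.withDensity f = μ := Measure.withDensity_rnDeriv_eq _ _
    (Measure.absolutelyContinuous_of_le (Measure.le_add_right le_rfl))
  have hνρ : ρ.withDensity g = ν := Measure.withDensity_rnDeriv_eq _ _
    (Measure.absolutelyContinuous_of_le (Measure.le_add_left le_rfl))
  have h1 : μ = ρ.withDensity (f - g) + ρ.withDensity (f ⊓ g) := by
    rw [← withDensity_add_left (hf.sub hg), ← hμρ]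
    congr 1
    ext x
    exact (tsub_add_min (a := f x) (b := g x)).symm
  have h2 : ν = ρ.withDensity (g - f) + ρ.withDensity (f ⊓ g) := by
    rw [← withDensity_add_left (hg.sub hf), ← hνρ, inf_comm]
    congr 1
    ext x
    exact (tsub_add_min (a := g x) (b := f x)).symm
  refine ⟨_, Radon.mono hμ ?_, _, Radon.mono hν ?_, _, Radon.mono hμ ?_, h1, h2, ?_⟩
  · exact (Measure.le_add_right le_rfl).trans_eq h1.symm
  · exact (Measure.le_add_right le_rfl).trans_eq h2.symm
  · exact (Measure.le_add_left le_rfl).trans_eq h1.symm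
  · refine Measure.MutuallySingular.mk (s := {x | f x ≤ g x}) (t := {x | g x ≤ f x}) ?_ ?_
      fun x _ => le_total (f x) (g x)
    · rw [withDensity_apply _ (measurableSet_le hf hg)]
      rw [setLIntegral_congr_fun (g := fun _ => 0) (measurableSet_le hf hg)]
      · simp
      · exact fun x hx => tsub_eq_zero_of_le hx
    · rw [withDensity_apply _ (measurableSet_le hg hf)]
      rw [setLIntegral_congr_fun (g := fun _ => 0) (measurableSet_le hg hf)]
      · simp
      · exact fun x hx => tsub_eq_zero_of_le hx

theorem two_mul_energy_le (hκ : IsKernel κ) (hE : EnergyPrinciple κ) {μ ν : Measure X}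
    (hμ : μ ∈ EPlus κ) (hν : ν ∈ EPlus κ) :
    2 * energy κ μ ν ≤ energy κ μ μ + energy κ ν ν ∧
      (2 * energy κ μ ν = energy κ μ μ + energy κ ν ν → μ = ν) := by
  obtain ⟨p, hp, q, hq, m, hm, rfl, rfl, hpq⟩ := exists_jordan hμ.1 hν.1
  have hpp : energy κ p p < ∞ := (energy_mono hκ (Measure.le_add_right le_rfl)
    (Measure.le_add_right le_rfl) hμ.1).trans_lt hμ.2
  have hqq : energy κ q q < ∞ := (energy_mono hκ (Measure.le_add_right le_rfl)
    (Measure.le_add_right le_rfl) hν.1).trans_lt hν.2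
  have hpm : energy κ p m < ∞ := (energy_mono hκ (Measure.le_add_right le_rfl)
    (Measure.le_add_left le_rfl) hμ.1).trans_lt hμ.2
  have hqm : energy κ q m < ∞ := (energy_mono hκ (Measure.le_add_right le_rfl)
    (Measure.le_add_left le_rfl) hν.1).trans_lt hν.2
  have hmm : energy κ m m < ∞ := (energy_mono hκ (Measure.le_add_left le_rfl)
    (Measure.le_add_left le_rfl) hν.1).trans_lt hν.2
  obtain ⟨h1, h2⟩ := hE p hp q hq hpq (Or.inl (ENNReal.add_lt_top.2 ⟨hpp, hqq⟩))
  have e1 : energy κ (p + m) (q + m)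
      = energy κ p q + (energy κ p m + energy κ q m + energy κ m m) := by
    rw [energy_add_left hκ _ _ hν.1, energy_add_right hκ _ hq hm, energy_add_right hκ _ hq hm,
      energy_comm hκ hm hq]
    ring
  have e2 : energy κ (p + m) (p + m) + energy κ (q + m) (q + m)
      = energy κ p p + energy κ q q + 2 * (energy κ p m + energy κ q m + energy κ m m) := by
    rw [energy_add_left hκ _ _ hν.1, energy_add_left hκ _ _ hμ.1, energy_add_right hκ _ hq hm,
      energy_add_right hκ _ hq hm, energy_add_right hκ _ hp hm, energy_add_right hκ _ hp hm,
      energy_comm hκ hm hq, energy_comm hκ hm hp]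
    ring
  rw [e1, e2, mul_add]
  have hfin : 2 * (energy κ p m + energy κ q m + energy κ m m) ≠ ∞ := by
    finiteness
  refine ⟨add_le_add_left h1 _, fun h => ?_⟩
  obtain ⟨rfl, rfl⟩ := h2 ((ENNReal.add_left_inj hfin).1 h)
  rfl

theorem energy_lt_top (hκ : IsKernel κ) (hE : EnergyPrinciple κ) {μ ν : Measure X}
    (hμ : μ ∈ EPlus κ) (hν : ν ∈ EPlus κ) : energy κ μ ν < ∞ := by
  have h := (two_mul_energy_le hκ hE hμ hν).1.trans_lt (ENNReal.add_lt_top.2 ⟨hμ.2, hν.2⟩)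
  refine lt_of_le_of_lt ?_ h
  rw [two_mul]
  exact le_self_add

theorem EPlus.add (hκ : IsKernel κ) (hE : EnergyPrinciple κ) {μ ν : Measure X}
    (hμ : μ ∈ EPlus κ) (hν : ν ∈ EPlus κ) : μ + ν ∈ EPlus κ := by
  refine ⟨Radon.add hμ.1 hν.1, ?_⟩
  rw [energy_add_left hκ _ _ (Radon.add hμ.1 hν.1), energy_add_right hκ _ hμ.1 hν.1,
    energy_add_right hκ _ hμ.1 hν.1]
  have := energy_lt_top hκ hE hμ hν
  have := energy_lt_top hκ hE hν hμ
  have := hμ.2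
  have := hν.2
  finiteness

theorem EPlus.smul (hκ : IsKernel κ) (c : ℝ≥0) {μ : Measure X} (hμ : μ ∈ EPlus κ) :
    c • μ ∈ EPlus κ := by
  refine ⟨Radon.smul c hμ.1, ?_⟩
  rw [energy_smul_left hκ _ _ (Radon.smul c hμ.1), energy_smul_right hκ _ hμ.1 hμ.1]
  have := hμ.2
  finiteness

theorem EPlus.mono (hκ : IsKernel κ) {μ ν : Measure X} (hν : ν ∈ EPlus κ) (h : μ ≤ ν) :
    μ ∈ EPlus κ :=
  ⟨Radon.mono hν.1 h, (energy_mono hκ h h hν.1).trans_lt hν.2⟩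

theorem EPlus.zero : (0 : Measure X) ∈ EPlus κ := ⟨Radon.zero, by simp [energy]⟩

theorem EPlusOn.add (hκ : IsKernel κ) (hE : EnergyPrinciple κ) {A : Set X} {μ ν : Measure X}
    (hμ : μ ∈ EPlusOn κ A) (hν : ν ∈ EPlusOn κ A) : μ + ν ∈ EPlusOn κ A :=
  ⟨EPlus.add hκ hE hμ.1 hν.1, by simp [hμ.2, hν.2]⟩

theorem EPlusOn.smul (hκ : IsKernel κ) (c : ℝ≥0) {A : Set X} {μ : Measure X}
    (hμ : μ ∈ EPlusOn κ A) : c • μ ∈ EPlusOn κ A :=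
  ⟨EPlus.smul hκ c hμ.1, by simp [hμ.2]⟩

theorem EPlusOn.mono (hκ : IsKernel κ) {A : Set X} {μ ν : Measure X} (hν : ν ∈ EPlusOn κ A)
    (h : μ ≤ ν) : μ ∈ EPlusOn κ A :=
  ⟨EPlus.mono hκ hν.1 h, le_antisymm ((h _).trans hν.2.le) zero_le⟩

theorem EPlusOn.zero {A : Set X} : (0 : Measure X) ∈ EPlusOn κ A := ⟨EPlus.zero, by simp⟩

/-- The mutual energy as a real number. -/
noncomputable def realEnergy (κ : X × X → ℝ≥0∞) (μ ν : Measure X) : ℝ := (energy κ μ ν).toReal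

/-- The square of the strong distance. -/
noncomputable def sqDist (κ : X × X → ℝ≥0∞) (μ ν : Measure X) : ℝ :=
  realEnergy κ μ μ + realEnergy κ ν ν - 2 * realEnergy κ μ ν

theorem strongDist_eq (μ ν : Measure X) : strongDist κ μ ν = √(sqDist κ μ ν) := rfl

theorem realEnergy_nonneg (μ ν : Measure X) : 0 ≤ realEnergy κ μ ν := ENNReal.toReal_nonneg

theorem realEnergy_comm (hκ : IsKernel κ) {μ ν : Measure X} (hμ : μ ∈ EPlus κ)
    (hν : ν ∈ EPlus κ) : realEnergy κ μ ν = realEnergy κ ν μ := by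
  rw [realEnergy, energy_comm hκ hμ.1 hν.1, realEnergy]

theorem realEnergy_add_left (hκ : IsKernel κ) (hE : EnergyPrinciple κ) {μ ν ρ : Measure X}
    (hμ : μ ∈ EPlus κ) (hν : ν ∈ EPlus κ) (hρ : ρ ∈ EPlus κ) :
    realEnergy κ (μ + ν) ρ = realEnergy κ μ ρ + realEnergy κ ν ρ := by
  rw [realEnergy, energy_add_left hκ _ _ hρ.1, ENNReal.toReal_add
    (energy_lt_top hκ hE hμ hρ).ne (energy_lt_top hκ hE hν hρ).ne, realEnergy, realEnergy]

theorem realEnergy_add_right (hκ : IsKernel κ) (hE : EnergyPrinciple κ) {μ ν ρ : Measure X}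
    (hμ : μ ∈ EPlus κ) (hν : ν ∈ EPlus κ) (hρ : ρ ∈ EPlus κ) :
    realEnergy κ ρ (μ + ν) = realEnergy κ ρ μ + realEnergy κ ρ ν := by
  rw [realEnergy, energy_add_right hκ _ hμ.1 hν.1, ENNReal.toReal_add
    (energy_lt_top hκ hE hρ hμ).ne (energy_lt_top hκ hE hρ hν).ne, realEnergy, realEnergy]

theorem realEnergy_smul_left (hκ : IsKernel κ) (c : ℝ≥0) {μ ρ : Measure X} (hρ : ρ ∈ EPlus κ) :
    realEnergy κ (c • μ) ρ = c * realEnergy κ μ ρ := by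
  rw [realEnergy, energy_smul_left hκ _ _ hρ.1, ENNReal.toReal_mul, realEnergy, ENNReal.coe_toReal]

theorem realEnergy_smul_right (hκ : IsKernel κ) (c : ℝ≥0) {μ ρ : Measure X} (hμ : μ ∈ EPlus κ)
    (hρ : ρ ∈ EPlus κ) : realEnergy κ ρ (c • μ) = c * realEnergy κ ρ μ := by
  rw [realEnergy, energy_smul_right hκ _ hμ.1 hρ.1, ENNReal.toReal_mul, realEnergy,
    ENNReal.coe_toReal]

theorem sqDist_comm (hκ : IsKernel κ) {μ ν : Measure X} (hμ : μ ∈ EPlus κ) (hν : ν ∈ EPlus κ) :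
    sqDist κ μ ν = sqDist κ ν μ := by
  rw [sqDist, sqDist, realEnergy_comm hκ hμ hν]
  ring

theorem sqDist_zero_right (μ : Measure X) : sqDist κ μ 0 = realEnergy κ μ μ := by
  simp [sqDist, realEnergy, energy]

theorem sqDist_nonneg (hκ : IsKernel κ) (hE : EnergyPrinciple κ) {μ ν : Measure X}
    (hμ : μ ∈ EPlus κ) (hν : ν ∈ EPlus κ) : 0 ≤ sqDist κ μ ν := by
  have h := ENNReal.toReal_mono (ENNReal.add_lt_top.2 ⟨hμ.2, hν.2⟩).ne
    (two_mul_energy_le hκ hE hμ hν).1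
  rw [ENNReal.toReal_mul, ENNReal.toReal_add hμ.2.ne hν.2.ne] at h
  simp only [ENNReal.toReal_ofNat] at h
  simp only [sqDist, realEnergy]
  linarith

theorem eq_of_sqDist_nonpos (hκ : IsKernel κ) (hE : EnergyPrinciple κ) {μ ν : Measure X}
    (hμ : μ ∈ EPlus κ) (hν : ν ∈ EPlus κ) (h : sqDist κ μ ν ≤ 0) : μ = ν := by
  obtain ⟨h1, h2⟩ := two_mul_energy_le hκ hE hμ hν
  refine h2 (le_antisymm h1 ?_)
  have h3 := energy_lt_top hκ hE hμ hν
  rw [← ENNReal.toReal_le_toReal (ENNReal.add_lt_top.2 ⟨hμ.2, hν.2⟩).ne (by finiteness),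
    ENNReal.toReal_mul, ENNReal.toReal_add hμ.2.ne hν.2.ne]
  simp only [sqDist, realEnergy] at h
  simp only [ENNReal.toReal_ofNat]
  linarith

theorem sqDist_add_smul_left (hκ : IsKernel κ) (hE : EnergyPrinciple κ) {μ ν α : Measure X}
    (hμ : μ ∈ EPlus κ) (hν : ν ∈ EPlus κ) (hα : α ∈ EPlus κ) (t : ℝ≥0) :
    sqDist κ (μ + t • α) ν = sqDist κ μ ν
      + 2 * t * (realEnergy κ μ α - realEnergy κ ν α) + t ^ 2 * realEnergy κ α α := by
  have ht := EPlus.smul hκ t hα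
  have hs := EPlus.add hκ hE hμ ht
  simp only [sqDist, realEnergy_add_left hκ hE hμ ht hs, realEnergy_add_left hκ hE hμ ht hν,
    realEnergy_add_right hκ hE hμ ht hμ, realEnergy_add_right hκ hE hμ ht ht,
    realEnergy_smul_left hκ t hμ, realEnergy_smul_left hκ t hν, realEnergy_smul_left hκ t ht,
    realEnergy_smul_right hκ t hα hα, realEnergy_smul_right hκ t hα hμ, realEnergy_comm hκ hα hμ,
    realEnergy_comm hκ hα hν]
  ring

/-- The Cauchy–Schwarz inequality for a signed and a positive measure. -/
theorem realEnergy_sub_sq_le (hκ : IsKernel κ) (hE : EnergyPrinciple κ) {μ ν α : Measure X}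
    (hμ : μ ∈ EPlus κ) (hν : ν ∈ EPlus κ) (hα : α ∈ EPlus κ) :
    (realEnergy κ μ α - realEnergy κ ν α) ^ 2 ≤ sqDist κ μ ν * realEnergy κ α α := by
  have key : ∀ x : ℝ, 0 ≤ realEnergy κ α α * (x * x)
      + 2 * (realEnergy κ μ α - realEnergy κ ν α) * x + sqDist κ μ ν := by
    intro x
    rcases le_total 0 x with hx | hx
    · lift x to ℝ≥0 using hx
      have h := sqDist_nonneg hκ hE (EPlus.add hκ hE hμ (EPlus.smul hκ x hα)) hν
      rw [sqDist_add_smul_left hκ hE hμ hν hα] at h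
      linarith
    · obtain ⟨y, rfl⟩ : ∃ y, x = -y := ⟨-x, by ring⟩
      have hy : 0 ≤ y := by linarith
      lift y to ℝ≥0 using hy
      have h := sqDist_nonneg hκ hE (EPlus.add hκ hE hν (EPlus.smul hκ y hα)) hμ
      rw [sqDist_add_smul_left hκ hE hν hμ hα, sqDist_comm hκ hν hμ] at h
      linarith
  have h := discrim_le_zero key
  rw [discrim] at h
  linarith

theorem realEnergy_sub_le (hκ : IsKernel κ) (hE : EnergyPrinciple κ) {μ ν α : Measure X}
    (hμ : μ ∈ EPlus κ) (hν : ν ∈ EPlus κ) (hα : α ∈ EPlus κ) :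
    |realEnergy κ μ α - realEnergy κ ν α| ≤ √(realEnergy κ α α) * strongDist κ μ ν := by
  rw [strongDist_eq, ← Real.sqrt_mul (realEnergy_nonneg _ _), mul_comm]
  exact Real.abs_le_sqrt (realEnergy_sub_sq_le hκ hE hμ hν hα)

theorem tendsto_realEnergy_left (hκ : IsKernel κ) (hE : EnergyPrinciple κ) {u : ℕ → Measure X}
    {μ α : Measure X} (hu : ∀ n, u n ∈ EPlus κ) (hμ : μ ∈ EPlus κ) (hα : α ∈ EPlus κ)
    (h : Tendsto (fun n => strongDist κ (u n) μ) atTop (𝓝 0)) :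
    Tendsto (fun n => realEnergy κ (u n) α) atTop (𝓝 (realEnergy κ μ α)) := by
  rw [tendsto_iff_dist_tendsto_zero]
  refine squeeze_zero (fun _ => dist_nonneg)
    (fun n => realEnergy_sub_le hκ hE (hu n) hμ hα) ?_
  simpa using h.const_mul _

theorem tendsto_realEnergy_self (hκ : IsKernel κ) (hE : EnergyPrinciple κ) {u : ℕ → Measure X}
    {μ : Measure X} (hu : ∀ n, u n ∈ EPlus κ) (hμ : μ ∈ EPlus κ)
    (h : Tendsto (fun n => strongDist κ (u n) μ) atTop (𝓝 0)) :
    Tendsto (fun n => realEnergy κ (u n) (u n)) atTop (𝓝 (realEnergy κ μ μ)) := by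
  have h1 := ((h.pow 2).add ((tendsto_realEnergy_left hκ hE hu hμ hμ h).const_mul 2)).sub_const
    (realEnergy κ μ μ)
  convert h1 using 2 with n
  · rw [strongDist_eq, Real.sq_sqrt (sqDist_nonneg hκ hE (hu n) hμ), sqDist]
    ring
  · ring

theorem innerCapacity_eq_zero_iff {A : Set X} :
    innerCapacity κ A = 0 ↔ ∀ μ, μ ∉ EPlusUnitOn κ A := by
  rw [innerCapacity, ENNReal.inv_eq_zero, iInf_eq_top]
  refine forall_congr' fun μ => ?_
  rw [iInf_eq_top]
  exact ⟨fun h hμ => hμ.1.1.2.ne (h hμ), fun h hμ => (h hμ).elim⟩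

theorem normalize_mem (hκ : IsKernel κ) {A : Set X} {μ : Measure X} (hμ : μ ∈ EPlusOn κ A)
    (h0 : μ univ ≠ 0) (hf : μ univ ≠ ∞) : (μ univ).toNNReal⁻¹ • μ ∈ EPlusUnitOn κ A := by
  refine ⟨EPlusOn.smul hκ _ hμ, ?_⟩
  rw [Measure.smul_apply, ENNReal.smul_def, smul_eq_mul,
    ENNReal.coe_inv (by simp [ENNReal.toNNReal_eq_zero_iff, h0, hf]), ENNReal.coe_toNNReal hf,
    ENNReal.inv_mul_cancel h0 hf]

/-- A measurable property holds nearly everywhere on `A` if and only if it holds almost everywhere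
for each measure of finite energy concentrated on `A`. -/
theorem nearlyEverywhereOn_iff (hκ : IsKernel κ) {A : Set X} {P : X → Prop}
    (hP : MeasurableSet {x | P x}) :
    NearlyEverywhereOn κ A P ↔ ∀ α ∈ EPlusOn κ A, ∀ᵐ x ∂α, P x := by
  rw [NearlyEverywhereOn, innerCapacity_eq_zero_iff]
  constructor
  · intro h α hα
    by_contra hne
    rw [ae_iff] at hne
    have := Radon.sigmaFinite hα.1.1
    obtain ⟨t, ht, htP, ht0, htf⟩ := Measure.exists_subset_measure_lt_top
      (μ := α) hP.compl (pos_iff_ne_zero.2 hne)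
    have hmem : α.restrict t ∈ EPlusOn κ {x ∈ A | ¬ P x} := by
      refine ⟨EPlus.mono hκ hα.1 Measure.restrict_le_self, ?_⟩
      rw [Measure.restrict_apply' ht]
      refine measure_mono_null (fun x hx => ?_) hα.2
      exact fun hA => hx.1 ⟨hA, htP hx.2⟩
    exact h _ (normalize_mem hκ hmem (by simpa using ht0.ne') (by simpa using htf.ne))
  · intro h μ hμ
    have hPμ := h μ ⟨hμ.1.1, measure_mono_null (compl_subset_compl.2 fun x hx => hx.1) hμ.1.2⟩
    have h1 : μ univ ≤ μ {x ∈ A | ¬ P x}ᶜ + μ {x | ¬ P x} := by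
      refine (measure_mono fun x _ => ?_).trans (measure_union_le _ _)
      by_cases hx : P x
      · exact Or.inl fun h => h.2 hx
      · exact Or.inr hx
    rw [hμ.1.2, ae_iff.1 hPμ, hμ.2] at h1
    simp at h1

/-- The Gauss functional for a general external field `-g`. -/
noncomputable def fieldFunctional (κ : X × X → ℝ≥0∞) (g : X → ℝ≥0∞) (μ : Measure X) : ℝ :=
  realEnergy κ μ μ - 2 * (∫⁻ x, g x ∂μ).toReal

theorem toReal_lintegral_add {g : X → ℝ≥0∞} {μ ν : Measure X} (hμ : ∫⁻ x, g x ∂μ < ∞)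
    (hν : ∫⁻ x, g x ∂ν < ∞) :
    (∫⁻ x, g x ∂(μ + ν)).toReal = (∫⁻ x, g x ∂μ).toReal + (∫⁻ x, g x ∂ν).toReal := by
  rw [lintegral_add_measure, ENNReal.toReal_add hμ.ne hν.ne]

theorem toReal_lintegral_smul {g : X → ℝ≥0∞} {μ : Measure X} (c : ℝ≥0) :
    (∫⁻ x, g x ∂(c • μ)).toReal = c * (∫⁻ x, g x ∂μ).toReal := by
  rw [lintegral_smul_measure, ENNReal.smul_def, smul_eq_mul, ENNReal.toReal_mul,
    ENNReal.coe_toReal]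

theorem exists_minimizer (hκ : IsKernel κ) (hE : EnergyPrinciple κ)
    (hC : ConsistencyPrinciple κ) {B : Set X} (hB : StronglyClosed κ B) {g : X → ℝ≥0∞}
    (hfin : ∀ μ ∈ EPlusOn κ B, ∫⁻ x, g x ∂μ < ∞)
    (hbdd : ∃ m : ℝ, ∀ μ ∈ EPlusOn κ B, m ≤ fieldFunctional κ g μ)
    (husc : ∀ (u : ℕ → Measure X) (μ : Measure X), (∀ n, u n ∈ EPlusOn κ B) → μ ∈ EPlusOn κ B →
      Tendsto (fun n => strongDist κ (u n) μ) atTop (𝓝 0) →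
      ∀ ε > 0, ∀ᶠ n in atTop, (∫⁻ x, g x ∂(u n)).toReal ≤ (∫⁻ x, g x ∂μ).toReal + ε) :
    ∃ ν ∈ EPlusOn κ B, ∀ μ ∈ EPlusOn κ B, fieldFunctional κ g ν ≤ fieldFunctional κ g μ := by
  set S := fieldFunctional κ g '' EPlusOn κ B
  have hne : S.Nonempty := ⟨_, _, EPlusOn.zero, rfl⟩
  have hbb : BddBelow S := by
    obtain ⟨m, hm⟩ := hbdd
    exact ⟨m, by rintro _ ⟨μ, hμ, rfl⟩; exact hm μ hμ⟩
  have hle : ∀ μ ∈ EPlusOn κ B, sInf S ≤ fieldFunctional κ g μ :=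
    fun μ hμ => csInf_le hbb ⟨μ, hμ, rfl⟩
  have hu : ∀ n : ℕ, ∃ μ ∈ EPlusOn κ B, fieldFunctional κ g μ < sInf S + 1 / (n + 1) := by
    intro n
    obtain ⟨_, ⟨μ, hμ, rfl⟩, h⟩ := exists_lt_of_csInf_lt hne
      (lt_add_of_pos_right (sInf S) (Nat.one_div_pos_of_nat (α := ℝ) (n := n)))
    exact ⟨μ, hμ, h⟩
  choose u huB hu using hu
  have hpar : ∀ m n, sqDist κ (u m) (u n) ≤ 2 * (1 / (m + 1)) + 2 * (1 / (n + 1)) := by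
    intro m n
    have hadd := EPlusOn.add hκ hE (huB m) (huB n)
    have hmid := hle _ (EPlusOn.smul hκ 2⁻¹ hadd)
    have h1 := hu m
    have h2 := hu n
    simp only [fieldFunctional, toReal_lintegral_smul,
      toReal_lintegral_add (hfin _ (huB m)) (hfin _ (huB n)),
      realEnergy_smul_left hκ 2⁻¹ (EPlus.smul hκ 2⁻¹ hadd.1),
      realEnergy_smul_right hκ 2⁻¹ hadd.1 hadd.1,
      realEnergy_add_left hκ hE (huB m).1 (huB n).1 hadd.1,
      realEnergy_add_right hκ hE (huB m).1 (huB n).1 (huB m).1,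
      realEnergy_add_right hκ hE (huB m).1 (huB n).1 (huB n).1,
      realEnergy_comm hκ (huB n).1 (huB m).1] at hmid h1 h2
    push_cast at hmid
    simp only [sqDist]
    linarith
  have hcauchy : ∀ ε > 0, ∃ N, ∀ m ≥ N, ∀ n ≥ N, strongDist κ (u m) (u n) < ε := by
    intro ε hε
    obtain ⟨N, hN⟩ := exists_nat_one_div_lt (show 0 < ε ^ 2 / 4 by positivity)
    refine ⟨N, fun m hm n hn => ?_⟩
    rw [strongDist_eq, Real.sqrt_lt' hε]
    have h1 := Nat.one_div_le_one_div (α := ℝ) hm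
    have h2 := Nat.one_div_le_one_div (α := ℝ) hn
    have := hpar m n
    linarith
  obtain ⟨ν, hν, hlim⟩ := hC.complete u (fun n => (huB n).1) hcauchy
  have hνB := hB u huB ν hν hlim
  refine ⟨ν, hνB, fun μ hμ => le_trans ?_ (hle μ hμ)⟩
  refine le_of_forall_pos_le_add fun ε hε => ?_
  have h1 := tendsto_realEnergy_self hκ hE (fun n => (huB n).1) hν hlim
  have h2 := h1.eventually (lt_mem_nhds (show realEnergy κ ν ν - ε / 4 < realEnergy κ ν ν by
    linarith))
  have h3 := husc u ν huB hνB hlim (ε / 4) (by linarith)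
  have h4 : ∀ᶠ n : ℕ in atTop, 1 / ((n : ℝ) + 1) < ε / 4 :=
    tendsto_one_div_add_atTop_nhds_zero_nat.eventually (gt_mem_nhds (by linarith))
  obtain ⟨n, h2, h3, h4⟩ := (h2.and (h3.and h4)).exists
  have h5 := hu n
  simp only [fieldFunctional] at h5 ⊢
  linarith

theorem realEnergy_add_smul (hκ : IsKernel κ) (hE : EnergyPrinciple κ) {μ α : Measure X}
    (hμ : μ ∈ EPlus κ) (hα : α ∈ EPlus κ) (t : ℝ≥0) :
    realEnergy κ (μ + t • α) (μ + t • α) = realEnergy κ μ μ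
      + 2 * t * realEnergy κ μ α + t ^ 2 * realEnergy κ α α := by
  have h := sqDist_add_smul_left hκ hE hμ (EPlus.zero (κ := κ)) hα t
  simp only [sqDist_zero_right] at h
  rw [h]
  simp [realEnergy, energy]

theorem nonneg_of_forall_small {a b : ℝ}
    (h : ∀ t : ℝ≥0, 0 < t → t ≤ 1 → 0 ≤ 2 * (t : ℝ) * a + (t : ℝ) ^ 2 * b) : 0 ≤ a := by
  by_contra! ha
  set t : ℝ := min 1 (-a / (|b| + 1)) with ht
  have hb : 0 < |b| + 1 := by positivity
  have ht0 : 0 < t := lt_min one_pos (div_pos (by linarith) hb)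
  have ht1 : t * (|b| + 1) ≤ -a := (le_div_iff₀ hb).1 (min_le_right _ _)
  have h1 := h ⟨t, ht0.le⟩ ht0 (NNReal.coe_le_coe.1 (min_le_left _ _))
  change 0 ≤ 2 * t * a + t ^ 2 * b at h1
  have h2 : t * (2 * a + t * b) < 0 := by
    refine mul_neg_of_pos_of_neg ht0 ?_
    have := mul_le_mul_of_nonneg_left (le_abs_self b) ht0.le
    linarith
  nlinarith

/-- Minimization of the Gauss functional over the whole cone `ℰ⁺(B)`. -/
theorem exists_ae_le_potential (hκ : IsKernel κ) (hE : EnergyPrinciple κ)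
    (hC : ConsistencyPrinciple κ) {B : Set X} (hB : StronglyClosed κ B) {g : X → ℝ≥0∞}
    (hg : Measurable g) (hfin : ∀ μ ∈ EPlusOn κ B, ∫⁻ x, g x ∂μ < ∞)
    (hbdd : ∃ m : ℝ, ∀ μ ∈ EPlusOn κ B, m ≤ fieldFunctional κ g μ)
    (husc : ∀ (u : ℕ → Measure X) (μ : Measure X), (∀ n, u n ∈ EPlusOn κ B) → μ ∈ EPlusOn κ B →
      Tendsto (fun n => strongDist κ (u n) μ) atTop (𝓝 0) →
      ∀ ε > 0, ∀ᶠ n in atTop, (∫⁻ x, g x ∂(u n)).toReal ≤ (∫⁻ x, g x ∂μ).toReal + ε) :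
    ∃ ν ∈ EPlusOn κ B, (∀ α ∈ EPlusOn κ B, g ≤ᵐ[α] potential κ ν) ∧
      g =ᵐ[ν] potential κ ν := by
  obtain ⟨ν, hν, hmin⟩ := exists_minimizer hκ hE hC hB hfin hbdd husc
  have hvar : ∀ α ∈ EPlusOn κ B, ∫⁻ x, g x ∂α ≤ ∫⁻ x, potential κ ν x ∂α := by
    intro α hα
    rw [← energy_eq_lintegral hκ _ hν.1.1, ← ENNReal.toReal_le_toReal (hfin α hα).ne
      (energy_lt_top hκ hE hα.1 hν.1).ne]
    change _ ≤ realEnergy κ α ν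
    rw [realEnergy_comm hκ hα.1 hν.1]
    refine sub_nonneg.1 (nonneg_of_forall_small (b := realEnergy κ α α) fun t _ _ => ?_)
    have h := hmin _ (EPlusOn.add hκ hE hν (EPlusOn.smul hκ t hα))
    rw [fieldFunctional, fieldFunctional, realEnergy_add_smul hκ hE hν.1 hα.1,
      toReal_lintegral_add (hfin _ hν) (hfin _ (EPlusOn.smul hκ t hα)),
      toReal_lintegral_smul] at h
    linarith
  have hle : ∀ α ∈ EPlusOn κ B, g ≤ᵐ[α] potential κ ν := by
    intro α hα
    have := Radon.sigmaFinite hα.1.1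
    exact ae_le_of_forall_setLIntegral_le_of_sigmaFinite hg fun s _ _ =>
      hvar _ (EPlusOn.mono hκ hα Measure.restrict_le_self)
  refine ⟨ν, hν, hle, ae_eq_of_ae_le_of_lintegral_le (hle ν hν) (hfin ν hν).ne
    (measurable_potential hκ hν.1.1).aemeasurable ?_⟩
  rw [← energy_eq_lintegral hκ _ hν.1.1, ← ENNReal.toReal_le_toReal hν.1.2.ne (hfin ν hν).ne]
  change realEnergy κ ν ν ≤ _
  refine sub_nonneg.1 (nonneg_of_forall_small (b := realEnergy κ ν ν) fun t ht ht1 => ?_)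
  have h := hmin _ (EPlusOn.smul hκ (1 - t) hν)
  rw [fieldFunctional, fieldFunctional, toReal_lintegral_smul,
    realEnergy_smul_left hκ _ (EPlus.smul hκ (1 - t) hν.1), realEnergy_smul_right hκ _ hν.1 hν.1,
    NNReal.coe_sub ht1, NNReal.coe_one] at h
  linarith

theorem exists_bump {K V : Set X} (hK : IsCompact K) (hV : IsOpen V) (hKV : K ⊆ V) :
    ∃ φ : X → ℝ, Continuous φ ∧ HasCompactSupport φ ∧ (∀ x, 0 ≤ φ x) ∧ ∀ μ ∈ Radon X,
      μ K ≤ ENNReal.ofReal (∫ x, φ x ∂μ) ∧ ENNReal.ofReal (∫ x, φ x ∂μ) ≤ μ V := by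
  obtain ⟨φ, h1, hs, hsV, h01⟩ := exists_continuousMap_one_of_isCompact_subset_isOpen hK hV hKV
  refine ⟨φ, φ.continuous, hs, fun x => (h01 x).1, fun μ hμ => ?_⟩
  have : IsFiniteMeasureOnCompacts μ := hμ
  rw [ofReal_integral_eq_lintegral_ofReal (φ.continuous.integrable_of_hasCompactSupport hs)
    (Eventually.of_forall fun x => (h01 x).1)]
  constructor
  · rw [← lintegral_indicator_one hK.measurableSet]
    refine lintegral_mono fun x => ?_
    by_cases hx : x ∈ K
    · simp [hx, h1 hx]
    · simp [hx]
  · rw [← lintegral_indicator_one hV.measurableSet]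
    refine lintegral_mono fun x => ?_
    by_cases hx : x ∈ V
    · simpa [hx] using (h01 x).2
    · simp [hx, image_eq_zero_of_notMem_tsupport fun h => hx (hsV h)]

theorem ConsistencyPrinciple.tendsto_integral (hC : ConsistencyPrinciple κ) {u : ℕ → Measure X}
    {μ : Measure X} (hu : ∀ n, u n ∈ EPlus κ) (hμ : μ ∈ EPlus κ)
    (h : Tendsto (fun n => strongDist κ (u n) μ) atTop (𝓝 0)) {φ : X → ℝ} (hφ : Continuous φ)
    (hs : HasCompactSupport φ) :
    Tendsto (fun n => ∫ x, φ x ∂(u n)) atTop (𝓝 (∫ x, φ x ∂μ)) := by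
  rw [Metric.tendsto_nhds]
  intro ε hε
  obtain ⟨δ, hδ, H⟩ := hC.finer μ hμ φ hφ hs ε hε
  filter_upwards [h.eventually (gt_mem_nhds hδ)] with n hn
  exact H _ (hu n) hn

theorem stronglyClosed_of_isCompact (hC : ConsistencyPrinciple κ) {K : Set X} (hK : IsCompact K) :
    StronglyClosed κ K := by
  intro u hu μ hμ hlim
  refine ⟨hμ, ?_⟩
  have := Radon.regular hμ.1
  rw [hK.isClosed.isOpen_compl.measure_eq_iSup_isCompact μ]
  refine le_antisymm (iSup_le fun C => iSup_le fun hCK => iSup_le fun hCc => ?_) zero_le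
  obtain ⟨φ, hφ, hs, hφ0, H⟩ := exists_bump hCc hK.isClosed.isOpen_compl hCK
  have hz : ∀ n, ∫ x, φ x ∂(u n) = 0 := by
    intro n
    have h1 := (H _ (hu n).1.1).2
    rw [(hu n).2] at h1
    exact le_antisymm (by simpa using h1) (integral_nonneg hφ0)
  have hl := hC.tendsto_integral (fun n => (hu n).1) hμ hlim hφ hs
  simp only [hz] at hl
  have h2 := (H _ hμ.1).1
  rw [← tendsto_nhds_unique tendsto_const_nhds hl] at h2
  rwa [ENNReal.ofReal_zero] at h2

theorem limsup_measure_le (hC : ConsistencyPrinciple κ) {u : ℕ → Measure X}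
    {μ : Measure X} (hu : ∀ n, u n ∈ EPlus κ) (hμ : μ ∈ EPlus κ)
    (h : Tendsto (fun n => strongDist κ (u n) μ) atTop (𝓝 0)) {K : Set X} (hK : IsCompact K) :
    limsup (fun n => u n K) atTop ≤ μ K := by
  have := Radon.regular hμ.1
  refine le_of_forall_gt fun c hc => ?_
  obtain ⟨V, hKV, hV, hVc⟩ := K.exists_isOpen_lt_of_lt c hc
  obtain ⟨φ, hφ, hs, hφ0, H⟩ := exists_bump hK hV hKV
  have hl := ENNReal.tendsto_ofReal (hC.tendsto_integral hu hμ h hφ hs)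
  refine lt_of_le_of_lt ?_ hVc
  calc limsup (fun n => u n K) atTop
      ≤ limsup (fun n => ENNReal.ofReal (∫ x, φ x ∂(u n))) atTop :=
        limsup_le_limsup (Eventually.of_forall fun n => (H _ (hu n).1).1)
    _ = ENNReal.ofReal (∫ x, φ x ∂μ) := hl.limsup_eq
    _ ≤ μ V := (H _ hμ.1).2

theorem exists_measure_le_of_tendsto (hC : ConsistencyPrinciple κ) {u : ℕ → Measure X}
    {μ : Measure X} (hu : ∀ n, u n ∈ EPlus κ) (hμ : μ ∈ EPlus κ)
    (h : Tendsto (fun n => strongDist κ (u n) μ) atTop (𝓝 0)) {K : Set X} (hK : IsCompact K) :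
    ∃ b : ℝ≥0, ∀ n, u n K ≤ b := by
  obtain ⟨φ, hφ, hs, hφ0, H⟩ := exists_bump hK isOpen_univ (subset_univ K)
  obtain ⟨b, hb⟩ := (hC.tendsto_integral hu hμ h hφ hs).bddAbove_range
  exact ⟨b.toNNReal, fun n => (H _ (hu n).1).1.trans (ENNReal.ofReal_le_ofReal (hb ⟨n, rfl⟩))⟩

theorem lintegral_eq_lintegral_meas_inter {K : Set X} (hK : IsCompact K) {g : X → ℝ≥0∞}
    (hg : Measurable g) {M : ℝ≥0} (hM : ∀ x ∈ K, g x ≤ M) {μ : Measure X} (hμ : μ Kᶜ = 0) :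
    ∫⁻ x, g x ∂μ = ∫⁻ t in Ioi (0 : ℝ), μ (K ∩ g ⁻¹' Ici (ENNReal.ofReal t)) := by
  set f : X → ℝ := K.indicator fun x => (g x).toReal with hf
  have hf0 : ∀ x, 0 ≤ f x := fun x => indicator_nonneg (fun _ _ => ENNReal.toReal_nonneg) x
  have hgf : ∫⁻ x, g x ∂μ = ∫⁻ x, ENNReal.ofReal (f x) ∂μ := by
    refine lintegral_congr_ae ?_
    filter_upwards [show ∀ᵐ x ∂μ, x ∈ K from hμ] with x hx
    rw [hf, indicator_of_mem hx, ENNReal.ofReal_toReal]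
    exact ((hM x hx).trans_lt ENNReal.coe_lt_top).ne
  rw [hgf, lintegral_eq_lintegral_meas_le μ (Eventually.of_forall hf0)
    (hg.ennreal_toReal.indicator hK.measurableSet).aemeasurable]
  refine setLIntegral_congr_fun measurableSet_Ioi fun t ht => ?_
  congr 1
  ext x
  by_cases hx : x ∈ K
  · have : g x ≠ ∞ := ((hM x hx).trans_lt ENNReal.coe_lt_top).ne
    simp [hf, hx, ENNReal.ofReal_le_iff_le_toReal this]
  · simpa [hf, hx] using ht

/-- Upper semicontinuity of `μ ↦ ∫ g dμ` on `ℰ⁺(K)` for a bounded field `g` which is upper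
semicontinuous on the compact set `K`. -/
theorem limsup_lintegral_le_of_upperSemicontinuousOn (hC : ConsistencyPrinciple κ) {K : Set X}
    (hK : IsCompact K) {g : X → ℝ≥0∞} (hg : Measurable g) (husc : UpperSemicontinuousOn g K)
    {M : ℝ≥0} (hM : ∀ x ∈ K, g x ≤ M) {u : ℕ → Measure X} {μ : Measure X}
    (hu : ∀ n, u n ∈ EPlusOn κ K) (hμ : μ ∈ EPlusOn κ K)
    (h : Tendsto (fun n => strongDist κ (u n) μ) atTop (𝓝 0)) :
    limsup (fun n => ∫⁻ x, g x ∂(u n)) atTop ≤ ∫⁻ x, g x ∂μ := by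
  obtain ⟨b, hb⟩ := exists_measure_le_of_tendsto hC (fun n => (hu n).1) hμ.1 h hK
  simp only [lintegral_eq_lintegral_meas_inter hK hg hM (hu _).2,
    lintegral_eq_lintegral_meas_inter hK hg hM hμ.2]
  refine (limsup_lintegral_le (fun t => (Iic (M : ℝ)).indicator (fun _ => (b : ℝ≥0∞)) t) (fun n => ?_)
    (fun n => ?_) ?_).trans (lintegral_mono fun t => ?_)
  · refine Antitone.measurable fun s t hst => measure_mono ?_
    exact inter_subset_inter_right _ (preimage_mono (Ici_subset_Ici.2 (ENNReal.ofReal_le_ofReal hst)))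
  · refine Eventually.of_forall fun t => ?_
    by_cases ht : t ≤ M
    · simpa [ht] using (measure_mono inter_subset_left).trans (hb n)
    · have : K ∩ g ⁻¹' Ici (ENNReal.ofReal t) = ∅ := by
        refine eq_empty_of_forall_notMem fun x hx => ht ?_
        have := hx.2.trans (hM x hx.1)
        rw [← ENNReal.ofReal_coe_nnreal] at this
        exact (ENNReal.ofReal_le_ofReal_iff M.coe_nonneg).1 this
      simp [this]
  · rw [lintegral_indicator measurableSet_Iic, Measure.restrict_restrict measurableSet_Iic]
    simp [Iic_inter_Ioi, ENNReal.mul_eq_top]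
  · exact limsup_measure_le hC (fun n => (hu n).1) hμ.1 h
      (husc.isCompact_inter_preimage_Ici hK _)

/-- The mass of a compact set is controlled by the energy. -/
theorem exists_measure_le_sqrt_energy (hκ : IsKernel κ) (hC : ConsistencyPrinciple κ)
    {K : Set X} (hK : IsCompact K) :
    ∃ C : ℝ, 0 ≤ C ∧ ∀ μ ∈ EPlus κ, μ K ≤ ENNReal.ofReal (C * √(realEnergy κ μ μ)) := by
  obtain ⟨φ, hφ, hs, hφ0, H⟩ := exists_bump hK isOpen_univ (subset_univ K)
  obtain ⟨δ, hδ, hfin⟩ := hC.finer 0 EPlus.zero φ hφ hs 1 one_pos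
  refine ⟨2 / δ, by positivity, fun μ hμ => (H μ hμ.1).1.trans (ENNReal.ofReal_le_ofReal ?_)⟩
  have hscale : ∀ c : ℝ≥0, c * √(realEnergy κ μ μ) < δ → c * ∫ x, φ x ∂μ < 1 := by
    intro c hc
    have h1 := hfin (c • μ) (EPlus.smul hκ c hμ) (by
      rw [strongDist_eq, sqDist_zero_right, realEnergy_smul_left hκ c (EPlus.smul hκ c hμ),
        realEnergy_smul_right hκ c hμ hμ, ← mul_assoc, Real.sqrt_mul (by positivity),
        Real.sqrt_mul_self c.coe_nonneg]
      exact hc)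
    simp only [integral_zero_measure, sub_zero, integral_smul_nnreal_measure] at h1
    exact lt_of_abs_lt h1
  have hm : 0 ≤ ∫ x, φ x ∂μ := integral_nonneg hφ0
  rcases (Real.sqrt_nonneg (realEnergy κ μ μ)).eq_or_lt with h0 | hpos
  · rw [← h0, mul_zero]
    by_contra! hlt
    have h2 := hscale ⟨1 / ∫ x, φ x ∂μ, by positivity⟩ (by rw [← h0]; simpa using hδ)
    change (1 / ∫ x, φ x ∂μ) * _ < 1 at h2
    rw [one_div_mul_cancel hlt.ne'] at h2
    exact lt_irrefl _ h2
  · have h2 := hscale ⟨δ / (2 * √(realEnergy κ μ μ)), by positivity⟩ (by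
      change δ / (2 * √(realEnergy κ μ μ)) * √(realEnergy κ μ μ) < δ
      field_simp
      linarith)
    change δ / (2 * √(realEnergy κ μ μ)) * _ < 1 at h2
    rw [div_mul_eq_mul_div, div_lt_one (by positivity)] at h2
    rw [div_mul_eq_mul_div, le_div_iff₀ hδ]
    linarith

theorem lintegral_le_of_forall_mem_le {K : Set X} {g : X → ℝ≥0∞} {M : ℝ≥0∞}
    (hM : ∀ x ∈ K, g x ≤ M) {μ : Measure X} (hμ : μ Kᶜ = 0) :
    ∫⁻ x, g x ∂μ ≤ M * μ univ := by
  rw [← lintegral_const]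
  refine lintegral_mono_ae ?_
  filter_upwards [show ∀ᵐ x ∂μ, x ∈ K from hμ] with x hx using hM x hx

theorem measure_univ_le_of_compl_eq_zero {K : Set X} {μ : Measure X} (hμ : μ Kᶜ = 0) :
    μ univ ≤ μ K := by
  rw [← union_compl_self K]
  exact (measure_union_le _ _).trans_eq (by rw [hμ, add_zero])

theorem exists_ae_le_potential_of_isCompact (hκ : IsKernel κ) (hE : EnergyPrinciple κ)
    (hC : ConsistencyPrinciple κ) {K : Set X} (hK : IsCompact K) {g : X → ℝ≥0∞}
    (hg : Measurable g) (husc : UpperSemicontinuousOn g K) {M : ℝ≥0} (hM : ∀ x ∈ K, g x ≤ M) :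
    ∃ ν ∈ EPlusOn κ K, (∀ α ∈ EPlusOn κ K, g ≤ᵐ[α] potential κ ν) ∧
      g =ᵐ[ν] potential κ ν := by
  obtain ⟨C, hC0, hmass⟩ := exists_measure_le_sqrt_energy hκ hC hK
  have hle : ∀ μ ∈ EPlusOn κ K,
      ∫⁻ x, g x ∂μ ≤ ENNReal.ofReal (M * (C * √(realEnergy κ μ μ))) := by
    intro μ hμ
    rw [ENNReal.ofReal_mul M.coe_nonneg, ENNReal.ofReal_coe_nnreal]
    exact (lintegral_le_of_forall_mem_le hM hμ.2).trans
      (mul_le_mul_right ((measure_univ_le_of_compl_eq_zero hμ.2).trans (hmass μ hμ.1)) _)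
  have hfin : ∀ μ ∈ EPlusOn κ K, ∫⁻ x, g x ∂μ < ∞ :=
    fun μ hμ => (hle μ hμ).trans_lt ENNReal.ofReal_lt_top
  refine exists_ae_le_potential hκ hE hC (stronglyClosed_of_isCompact hC hK) hg hfin
    ⟨-(M * C) ^ 2, fun μ hμ => ?_⟩ fun u μ hu hμ hlim ε hε => ?_
  · have h1 := ENNReal.toReal_le_of_le_ofReal (by positivity) (hle μ hμ)
    have h2 := Real.sq_sqrt (realEnergy_nonneg (κ := κ) μ μ)
    rw [fieldFunctional]
    nlinarith [sq_nonneg (√(realEnergy κ μ μ) - M * C)]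
  · have h1 := limsup_lintegral_le_of_upperSemicontinuousOn hC hK hg husc hM hu hμ hlim
    have h2 : ∫⁻ x, g x ∂μ < ∫⁻ x, g x ∂μ + ENNReal.ofReal ε :=
      ENNReal.lt_add_right (hfin μ hμ).ne (by simpa using hε)
    filter_upwards [eventually_lt_of_limsup_lt (h1.trans_lt h2)] with n hn
    have h3 := ENNReal.toReal_mono
      (ENNReal.add_lt_top.2 ⟨hfin μ hμ, ENNReal.ofReal_lt_top⟩).ne hn.le
    rwa [ENNReal.toReal_add (hfin μ hμ).ne ENNReal.ofReal_ne_top,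
      ENNReal.toReal_ofReal hε.le] at h3

/-- The principle of positivity of mass. -/
theorem measure_univ_le_of_potential_le (hκ : IsKernel κ) (hE : EnergyPrinciple κ)
    (hC : ConsistencyPrinciple κ) (hF : FrostmanPrinciple κ) {μ ν : Measure X}
    (hμ : μ ∈ EPlus κ) (hν : ν ∈ Radon X) (h : ∀ x, potential κ μ x ≤ potential κ ν x) :
    μ univ ≤ ν univ := by
  have := Radon.regular hμ.1
  rw [isOpen_univ.measure_eq_iSup_isCompact μ]
  refine iSup_le fun K => iSup_le fun _ => iSup_le fun hK => ?_
  obtain ⟨γ, hγ, hle, heq⟩ := exists_ae_le_potential_of_isCompact hκ hE hC hK (g := fun _ => 1)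
    measurable_const upperSemicontinuousOn_const (M := 1) (by simp)
  have hone := hF γ hγ.1 1 one_pos (heq.mono fun x hx => by simpa using hx.symm.le)
  have hμK : μ.restrict K ∈ EPlusOn κ K :=
    ⟨EPlus.mono hκ hμ Measure.restrict_le_self, by
      rw [Measure.restrict_apply hK.measurableSet.compl]; simp⟩
  calc μ K = ∫⁻ _, 1 ∂(μ.restrict K) := by simp
    _ ≤ ∫⁻ x, potential κ γ x ∂(μ.restrict K) := lintegral_mono_ae (hle _ hμK)
    _ ≤ ∫⁻ x, potential κ γ x ∂μ := lintegral_mono' Measure.restrict_le_self fun _ => le_rfl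
    _ = energy κ γ μ := by rw [← energy_eq_lintegral hκ _ hγ.1.1, energy_comm hκ hμ.1 hγ.1.1]
    _ ≤ energy κ γ ν := by
      rw [energy_eq_lintegral hκ _ hμ.1, energy_eq_lintegral hκ _ hν]
      exact lintegral_mono h
    _ = ∫⁻ x, potential κ γ x ∂ν := by
      rw [energy_comm hκ hγ.1.1 hν, energy_eq_lintegral hκ _ hγ.1.1]
    _ ≤ ∫⁻ _, 1 ∂ν := lintegral_mono fun x => by simpa using hone x
    _ = ν univ := by simp

/-- The functional `μ ↦ ∫ U^ω dμ` is finite and strongly Lipschitz on `ℰ⁺(A)`. -/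
def LipschitzField (κ : X × X → ℝ≥0∞) (A : Set X) (ω : Measure X) (C : ℝ) : Prop :=
  (∀ μ ∈ EPlusOn κ A, ∫⁻ x, potential κ ω x ∂μ < ∞) ∧
    ∀ μ ∈ EPlusOn κ A, ∀ ν ∈ EPlusOn κ A,
      (∫⁻ x, potential κ ω x ∂μ).toReal - (∫⁻ x, potential κ ω x ∂ν).toReal
        ≤ C * strongDist κ μ ν

theorem LipschitzField.exists_balayage (hκ : IsKernel κ) (hE : EnergyPrinciple κ)
    (hC : ConsistencyPrinciple κ) (hD : DominationPrinciple κ) {A : Set X}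
    (hA : StronglyClosed κ A) {ω : Measure X} (hω : ω ∈ Radon X) {C : ℝ}
    (hL : LipschitzField κ A ω C) :
    ∃ ν ∈ EPlusOn κ A, ∀ α ∈ EPlusOn κ A, potential κ ν =ᵐ[α] potential κ ω := by
  obtain ⟨hfin, hlip⟩ := hL
  suffices h : ∃ ν ∈ EPlusOn κ A, (∀ α ∈ EPlusOn κ A, potential κ ω ≤ᵐ[α] potential κ ν) ∧
      potential κ ω =ᵐ[ν] potential κ ν by
    obtain ⟨ν, hν, hle, heq⟩ := h
    exact ⟨ν, hν, fun α hα => EventuallyLE.antisymm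
      (Eventually.of_forall (hD ν hν.1 ω hω heq.symm.le)) (hle α hα)⟩
  refine exists_ae_le_potential hκ hE hC hA (measurable_potential hκ hω) hfin
    ⟨-C ^ 2, fun μ hμ => ?_⟩ fun u μ hu hμ hlim ε hε => ?_
  · have h1 := hlip μ hμ 0 EPlusOn.zero
    have h2 := Real.sq_sqrt (realEnergy_nonneg (κ := κ) μ μ)
    rw [strongDist_eq, sqDist_zero_right] at h1
    simp only [lintegral_zero_measure, ENNReal.toReal_zero, sub_zero] at h1
    rw [fieldFunctional]
    nlinarith [sq_nonneg (√(realEnergy κ μ μ) - C)]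
  · have h1 : Tendsto (fun n => C * strongDist κ (u n) μ) atTop (𝓝 0) := by
      simpa using hlim.const_mul C
    filter_upwards [h1.eventually (gt_mem_nhds hε)] with n hn
    have := hlip _ (hu n) μ hμ
    linarith

theorem lipschitzField_of_mem_EPlus (hκ : IsKernel κ) (hE : EnergyPrinciple κ) {A : Set X}
    {ω : Measure X} (hω : ω ∈ EPlus κ) : LipschitzField κ A ω √(realEnergy κ ω ω) := by
  refine ⟨fun μ hμ => ?_, fun μ hμ ν hν => ?_⟩
  · rw [← energy_eq_lintegral hκ _ hω.1]
    exact energy_lt_top hκ hE hμ.1 hω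
  · rw [← energy_eq_lintegral hκ _ hω.1, ← energy_eq_lintegral hκ _ hω.1]
    exact (le_abs_self _).trans (realEnergy_sub_le hκ hE hμ.1 hν.1 hω)

theorem exists_isCompact_exhaustion {A : Set X} {ρ : Measure X} (hρ : ρ ∈ Radon X)
    (hA : ρ Aᶜ = 0) : ∃ K : ℕ → Set X, Monotone K ∧ (∀ n, IsCompact (K n)) ∧ (∀ n, K n ⊆ A) ∧
      ρ (⋃ n, K n)ᶜ = 0 := by
  have := Radon.sigmaFinite hρ
  set B := (toMeasurable ρ Aᶜ)ᶜ with hB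
  have hBm : MeasurableSet B := (measurableSet_toMeasurable _ _).compl
  have hBA : B ⊆ A := compl_subset_comm.1 (subset_toMeasurable ρ Aᶜ)
  have hB0 : ρ Bᶜ = 0 := by rw [hB, compl_compl, measure_toMeasurable, hA]
  have hK : ∀ n : ℕ, ∃ K ⊆ B, IsCompact K ∧ ρ.toFinite (B \ K) < ((n : ℝ≥0∞) + 1)⁻¹ := fun n =>
    hBm.exists_isCompact_sdiff_lt (measure_ne_top _ _)
      (ENNReal.inv_ne_zero.2 (by finiteness))
  choose K hKB hKc hKlt using hK
  refine ⟨accumulate K, monotone_accumulate, fun n => ?_, fun n => ?_, ?_⟩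
  · exact (finite_Iic n).isCompact_biUnion fun i _ => hKc i
  · exact iUnion₂_subset fun i _ => (hKB i).trans hBA
  · rw [iUnion_accumulate]
    have h1 : ρ.toFinite (B \ ⋃ n, K n) = 0 := by
      refine le_antisymm (ge_of_tendsto' (x := atTop)
        (f := fun n : ℕ => ((n : ℝ≥0∞) + 1)⁻¹) ?_ fun n => ?_) zero_le
      · simpa using (tendsto_add_atTop_iff_nat (f := fun n : ℕ => (n : ℝ≥0∞)⁻¹) 1).2
          ENNReal.tendsto_inv_nat_nhds_zero
      · exact (measure_mono (sdiff_subset_sdiff_right (subset_iUnion K n))).trans (hKlt n).le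
    have h2 := absolutelyContinuous_toFinite ρ h1
    refine le_antisymm ((measure_mono (t := Bᶜ ∪ (B \ ⋃ n, K n)) fun x hx => ?_).trans
      ((measure_union_le _ _).trans_eq (by rw [hB0, h2, add_zero]))) zero_le
    by_cases hxB : x ∈ B
    · exact Or.inr ⟨hxB, hx⟩
    · exact Or.inl hxB

theorem tendsto_setLIntegral_of_monotone {α : Type*} [MeasurableSpace α] {μ : Measure α}
    {s : ℕ → Set α} (hs : Monotone s) (h0 : μ (⋃ n, s n)ᶜ = 0) (f : α → ℝ≥0∞) :
    Tendsto (fun n => ∫⁻ x in s n, f x ∂μ) atTop (𝓝 (∫⁻ x, f x ∂μ)) := by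
  have h1 : ∫⁻ x, f x ∂μ = ⨆ n, ∫⁻ x in s n, f x ∂μ := by
    rw [← setLIntegral_iUnion_of_directed f hs.directed_le,
      Measure.restrict_eq_self_of_ae_mem (show ∀ᵐ x ∂μ, x ∈ ⋃ n, s n from h0)]
  rw [h1]
  exact tendsto_atTop_iSup fun m n hmn => lintegral_mono' (Measure.restrict_mono (hs hmn) le_rfl)
    fun _ => le_rfl

theorem tendsto_energy_restrict {μ ν : Measure X} (hμ : μ ∈ Radon X) (hν : ν ∈ Radon X)
    {s : ℕ → Set X} (hs : Monotone s) (hμs : μ (⋃ n, s n)ᶜ = 0) (hνs : ν (⋃ n, s n)ᶜ = 0) :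
    Tendsto (fun n => energy κ (μ.restrict (s n)) (ν.restrict (s n))) atTop
      (𝓝 (energy κ μ ν)) := by
  have := Radon.sigmaFinite hμ
  have := Radon.sigmaFinite hν
  simp only [energy, Measure.prod_restrict]
  refine tendsto_setLIntegral_of_monotone (fun m n hmn => prod_mono (hs hmn) (hs hmn)) ?_ _
  have h1 : (μ.prod ν) ((⋃ n, s n)ᶜ ×ˢ univ) = 0 := by rw [Measure.prod_prod, hμs, zero_mul]
  have h2 : (μ.prod ν) (univ ×ˢ (⋃ n, s n)ᶜ) = 0 := by rw [Measure.prod_prod, hνs, mul_zero]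
  refine measure_mono_null (fun p hp => ?_) (measure_union_null h1 h2)
  by_contra hcon
  simp only [mem_union, mem_prod, mem_univ, and_true, true_and, mem_compl_iff, not_or,
    not_not] at hcon
  obtain ⟨⟨m, hm⟩, ⟨n, hn⟩⟩ := hcon.imp mem_iUnion.1 mem_iUnion.1
  exact hp (mem_iUnion.2 ⟨max m n, hs (le_max_left m n) hm, hs (le_max_right m n) hn⟩)

theorem LipschitzField.of_isCompact (hκ : IsKernel κ) (hE : EnergyPrinciple κ) {A : Set X}
    {ω : Measure X} {C : ℝ} (hC : 0 ≤ C)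
    (h : ∀ K, IsCompact K → K ⊆ A → LipschitzField κ K ω C) : LipschitzField κ A ω C := by
  have hres : ∀ {μ : Measure X} {K : Set X}, IsCompact K → μ ∈ EPlusOn κ A →
      μ.restrict K ∈ EPlusOn κ K := fun hK hμ =>
    ⟨EPlus.mono hκ hμ.1 Measure.restrict_le_self, by
      rw [Measure.restrict_apply hK.measurableSet.compl]; simp⟩
  have hfin : ∀ μ ∈ EPlusOn κ A, ∫⁻ x, potential κ ω x ∂μ < ∞ := by
    intro μ hμ
    obtain ⟨K, hmono, hK, hKA, hK0⟩ := exists_isCompact_exhaustion hμ.1.1 hμ.2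
    refine (le_of_tendsto' (tendsto_setLIntegral_of_monotone hmono hK0 (potential κ ω))
      fun n => ?_).trans_lt (ENNReal.ofReal_lt_top (r := C * √(realEnergy κ μ μ)))
    obtain ⟨h1, h2⟩ := h _ (hK n) (hKA n)
    have h3 := h2 _ (hres (hK n) hμ) 0 EPlusOn.zero
    rw [strongDist_eq, sqDist_zero_right] at h3
    simp only [lintegral_zero_measure, ENNReal.toReal_zero, sub_zero] at h3
    rw [← ENNReal.ofReal_toReal (h1 _ (hres (hK n) hμ)).ne]
    refine ENNReal.ofReal_le_ofReal (h3.trans ?_)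
    gcongr
    exact ENNReal.toReal_mono hμ.1.2.ne (energy_mono hκ Measure.restrict_le_self
      Measure.restrict_le_self hμ.1.1)
  refine ⟨hfin, fun μ hμ ν hν => ?_⟩
  obtain ⟨K, hmono, hK, hKA, hK0⟩ := exists_isCompact_exhaustion (A := A) (ρ := μ + ν)
    (Radon.add hμ.1.1 hν.1.1) (by simp [hμ.2, hν.2])
  simp only [Measure.add_apply, add_eq_zero] at hK0
  have hint : ∀ {ρ : Measure X}, ρ ∈ EPlusOn κ A → ρ (⋃ n, K n)ᶜ = 0 →
      Tendsto (fun n => (∫⁻ x, potential κ ω x ∂(ρ.restrict (K n))).toReal) atTop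
        (𝓝 (∫⁻ x, potential κ ω x ∂ρ).toReal) := fun hρ h0 =>
    (ENNReal.tendsto_toReal (hfin _ hρ).ne).comp (tendsto_setLIntegral_of_monotone hmono h0 _)
  have hen : ∀ {ρ σ : Measure X}, ρ ∈ EPlusOn κ A → ρ (⋃ n, K n)ᶜ = 0 → σ ∈ EPlusOn κ A →
      σ (⋃ n, K n)ᶜ = 0 →
      Tendsto (fun n => realEnergy κ (ρ.restrict (K n)) (σ.restrict (K n))) atTop
        (𝓝 (realEnergy κ ρ σ)) := fun hρ h0 hσ h0' =>
    (ENNReal.tendsto_toReal (energy_lt_top hκ hE hρ.1 hσ.1).ne).comp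
      (tendsto_energy_restrict hρ.1.1 hσ.1.1 hmono h0 h0')
  refine le_of_tendsto_of_tendsto' ((hint hμ hK0.1).sub (hint hν hK0.2))
    (((((hen hμ hK0.1 hμ hK0.1).add (hen hν hK0.2 hν hK0.2)).sub
      ((hen hμ hK0.1 hν hK0.2).const_mul 2)).sqrt).const_mul C) fun n => ?_
  exact (h _ (hK n) (hKA n)).2 _ (hres (hK n) hμ) _ (hres (hK n) hν)

theorem lipschitzField_of_bounded (hκ : IsKernel κ) (hE : EnergyPrinciple κ)
    (hC : ConsistencyPrinciple κ) (hD : DominationPrinciple κ) (hF : FrostmanPrinciple κ)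
    {A : Set X} {ω : Measure X} (hω : ω ∈ Radon X) (hfin : ω univ < ∞)
    (husc : ∀ K : Set X, IsCompact K → K ⊆ A → UpperSemicontinuousOn (potential κ ω) K)
    {M : ℝ≥0} (hM : ∀ x ∈ A, potential κ ω x ≤ M) :
    LipschitzField κ A ω √(M * (ω univ).toReal) := by
  refine LipschitzField.of_isCompact hκ hE (Real.sqrt_nonneg _) fun K hK hKA => ?_
  obtain ⟨ν, hν, hle, heq⟩ := exists_ae_le_potential_of_isCompact hκ hE hC hK
    (measurable_potential hκ hω) (husc K hK hKA) fun x hx => hM x (hKA hx)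
  have hdom := hD ν hν.1 ω hω heq.symm.le
  have hae : ∀ α ∈ EPlusOn κ K, ∫⁻ x, potential κ ω x ∂α = energy κ α ν := by
    intro α hα
    rw [energy_eq_lintegral hκ _ hν.1.1]
    exact lintegral_congr_ae (EventuallyLE.antisymm (hle α hα) (Eventually.of_forall hdom))
  have hνω : realEnergy κ ν ν ≤ M * (ω univ).toReal := by
    have h1 : energy κ ν ν ≤ M * ω univ := by
      rw [← hae ν hν]
      refine (lintegral_le_of_forall_mem_le (fun x hx => hM x (hKA hx)) hν.2).trans ?_
      refine mul_le_mul_right ?_ _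
      exact measure_univ_le_of_potential_le hκ hE hC hF hν.1 hω hdom
    have h2 := ENNReal.toReal_mono (by finiteness) h1
    rwa [ENNReal.toReal_mul, ENNReal.coe_toReal] at h2
  refine ⟨fun μ hμ => ?_, fun μ hμ σ hσ => ?_⟩
  · rw [hae μ hμ]
    exact energy_lt_top hκ hE hμ.1 hν.1
  · rw [hae μ hμ, hae σ hσ]
    refine (le_abs_self _).trans ((realEnergy_sub_le hκ hE hμ.1 hσ.1 hν.1).trans ?_)
    exact mul_le_mul_of_nonneg_right (Real.sqrt_le_sqrt hνω) (Real.sqrt_nonneg _)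

theorem Admissible.exists_lipschitzField (hκ : IsKernel κ) (hE : EnergyPrinciple κ)
    (hC : ConsistencyPrinciple κ) (hD : DominationPrinciple κ) (hF : FrostmanPrinciple κ)
    {A : Set X} {ω : Measure X} (hω : Admissible κ A ω) : ∃ C, LipschitzField κ A ω C := by
  rcases hω.cases with h | ⟨h1, h2, h3⟩
  · exact ⟨_, lipschitzField_of_mem_EPlus hκ hE h⟩
  · refine ⟨_, lipschitzField_of_bounded hκ hE hC hD hF hω.radon h1 h2
      (M := (⨆ x ∈ A, potential κ ω x).toNNReal) fun x hx => ?_⟩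
    rw [ENNReal.coe_toNNReal h3.ne]
    exact le_iSup₂ (f := fun x _ => potential κ ω x) x hx

theorem isInnerBalayage_iff (hκ : IsKernel κ) {A : Set X} {ω ν : Measure X} (hω : ω ∈ Radon X) :
    IsInnerBalayage κ A ω ν ↔
      ν ∈ EPlusOn κ A ∧ ∀ α ∈ EPlusOn κ A, potential κ ν =ᵐ[α] potential κ ω :=
  and_congr_right fun hν => nearlyEverywhereOn_iff hκ
    (measurableSet_eq_fun (measurable_potential hκ hν.1.1) (measurable_potential hκ hω))

theorem IsInnerBalayage.unique (hκ : IsKernel κ) (hE : EnergyPrinciple κ) {A : Set X}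
    {ω ν ν' : Measure X} (hω : ω ∈ Radon X) (hν : IsInnerBalayage κ A ω ν)
    (hν' : IsInnerBalayage κ A ω ν') : ν = ν' := by
  rw [isInnerBalayage_iff hκ hω] at hν hν'
  have h : ∀ α ∈ EPlusOn κ A, energy κ α ν = energy κ α ν' := by
    intro α hα
    rw [energy_eq_lintegral hκ _ hν.1.1.1, energy_eq_lintegral hκ _ hν'.1.1.1]
    exact lintegral_congr_ae ((hν.2 α hα).trans (hν'.2 α hα).symm)
  refine eq_of_sqDist_nonpos hκ hE hν.1.1 hν'.1.1 (le_of_eq ?_)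
  have h1 := h ν hν.1
  have h2 := h ν' hν'.1
  rw [energy_comm hκ hν'.1.1.1 hν.1.1.1] at h2
  simp only [sqDist, realEnergy, h1, ← h2]
  ring

theorem IsInnerBalayage.lintegral_eq (hκ : IsKernel κ) {A : Set X} {ω ν α : Measure X}
    (hω : ω ∈ Radon X) (hν : IsInnerBalayage κ A ω ν) (hα : α ∈ EPlusOn κ A) :
    ∫⁻ x, potential κ ω x ∂α = energy κ α ν := by
  rw [energy_eq_lintegral hκ _ hν.1.1.1]
  exact lintegral_congr_ae (((isInnerBalayage_iff hκ hω).1 hν).2 α hα).symm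

theorem IsInnerBalayage.gauss_eq (hκ : IsKernel κ) {A : Set X} {ω ν α : Measure X}
    (hω : ω ∈ Radon X) (hν : IsInnerBalayage κ A ω ν) (hα : α ∈ EPlusOn κ A) :
    gauss κ ω α = sqDist κ α ν - realEnergy κ ν ν := by
  rw [gauss, hν.lintegral_eq hκ hω hα]
  simp only [sqDist, realEnergy]
  ring

theorem IsInnerBalayage.integrable_weightedPotential (hκ : IsKernel κ) (hE : EnergyPrinciple κ)
    {A : Set X} {ω ν lam : Measure X} (hω : ω ∈ Radon X) (hν : IsInnerBalayage κ A ω ν)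
    (hlam : lam ∈ EPlusOn κ A) :
    (∀ᵐ x ∂lam, potential κ lam x < ∞ ∧ potential κ ω x < ∞) ∧
      Integrable (weightedPotential κ ω lam) lam ∧
      weightedConstant κ ω lam = realEnergy κ lam lam - realEnergy κ lam ν := by
  have hm1 := measurable_potential hκ hlam.1.1
  have hm2 := measurable_potential hκ hω
  have h1 : ∫⁻ x, potential κ lam x ∂lam < ∞ := by
    rw [← energy_eq_lintegral hκ _ hlam.1.1]
    exact hlam.1.2
  have h2 : ∫⁻ x, potential κ ω x ∂lam < ∞ := by
    rw [hν.lintegral_eq hκ hω hlam]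
    exact energy_lt_top hκ hE hlam.1 hν.1.1
  have h3 := ae_lt_top hm1 h1.ne
  have h4 := ae_lt_top hm2 h2.ne
  have h5 := integrable_toReal_of_lintegral_ne_top hm1.aemeasurable h1.ne
  have h6 := integrable_toReal_of_lintegral_ne_top hm2.aemeasurable h2.ne
  refine ⟨h3.and h4, h5.sub h6, ?_⟩
  simp only [weightedConstant, weightedPotential]
  rw [integral_sub h5 h6, integral_toReal hm1.aemeasurable h3,
    integral_toReal hm2.aemeasurable h4, hν.lintegral_eq hκ hω hlam,
    ← energy_eq_lintegral hκ _ hlam.1.1, realEnergy, realEnergy]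

theorem sqDist_combination (hκ : IsKernel κ) (hE : EnergyPrinciple κ) {μ ν α : Measure X}
    (hμ : μ ∈ EPlus κ) (hν : ν ∈ EPlus κ) (hα : α ∈ EPlus κ) {t : ℝ≥0} (ht : t ≤ 1) :
    sqDist κ ((1 - t) • μ + t • α) ν = sqDist κ μ ν
      + 2 * t * ((realEnergy κ α μ - realEnergy κ α ν) - (realEnergy κ μ μ - realEnergy κ μ ν))
      + t ^ 2 * sqDist κ μ α := by
  have hs := EPlus.smul hκ (1 - t) hμ
  have h := sqDist_add_smul_left hκ hE hs hν hα t
  rw [h]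
  simp only [sqDist, realEnergy_smul_left hκ _ hs, realEnergy_smul_left hκ _ hα,
    realEnergy_smul_left hκ _ hν, realEnergy_smul_right hκ _ hμ hμ, NNReal.coe_sub ht,
    NNReal.coe_one, realEnergy_comm hκ hν hα, realEnergy_comm hκ hα hμ]
  ring

/-- The first variation of the Gauss functional at a minimizer. -/
theorem IsGaussMinimizer.weightedConstant_le (hκ : IsKernel κ) (hE : EnergyPrinciple κ)
    {A : Set X} {ω ν lam μ : Measure X} (hω : ω ∈ Radon X) (hν : IsInnerBalayage κ A ω ν)
    (hlam : IsGaussMinimizer κ A ω lam) (hμ : μ ∈ EPlusUnitOn κ A) :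
    realEnergy κ lam lam - realEnergy κ lam ν ≤ realEnergy κ μ lam - realEnergy κ μ ν := by
  refine sub_nonneg.1 (nonneg_of_forall_small (b := sqDist κ lam μ) fun t _ ht => ?_)
  have hmem : (1 - t) • lam + t • μ ∈ EPlusUnitOn κ A := by
    refine ⟨EPlusOn.add hκ hE (EPlusOn.smul hκ _ hlam.1.1) (EPlusOn.smul hκ _ hμ.1), ?_⟩
    rw [Measure.add_apply, Measure.smul_apply, Measure.smul_apply, hlam.1.2, hμ.2, ← add_smul,
      tsub_add_cancel_of_le ht, one_smul]
  have h := hlam.2 _ hmem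
  rw [hν.gauss_eq hκ hω hlam.1.1, hν.gauss_eq hκ hω hmem.1,
    sqDist_combination hκ hE hlam.1.1.1 hν.1.1 hμ.1.1 ht] at h
  linarith

/-- The characteristic inequalities for the potential of a solution of the Gauss problem. -/
theorem IsGaussMinimizer.ae_le (hκ : IsKernel κ) (hE : EnergyPrinciple κ) {A : Set X}
    {ω ν lam α : Measure X} (hω : ω ∈ Radon X) (hν : IsInnerBalayage κ A ω ν)
    (hlam : IsGaussMinimizer κ A ω lam) {p q : ℝ≥0}
    (hpq : (p : ℝ) - q = realEnergy κ lam lam - realEnergy κ lam ν) (hα : α ∈ EPlusOn κ A) :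
    (fun x => potential κ ν x + p) ≤ᵐ[α] fun x => potential κ lam x + q := by
  have := Radon.sigmaFinite hα.1.1
  refine ae_le_of_forall_setLIntegral_le_of_sigmaFinite
    ((measurable_potential hκ hν.1.1.1).add_const _) fun s _ hsf => ?_
  rw [lintegral_add_left (measurable_potential hκ hν.1.1.1),
    lintegral_add_left (measurable_potential hκ hlam.1.1.1.1),
    ← energy_eq_lintegral hκ _ hν.1.1.1, ← energy_eq_lintegral hκ _ hlam.1.1.1.1,
    lintegral_const, lintegral_const]
  set β := α.restrict s with hβ
  have hβA : β ∈ EPlusOn κ A := EPlusOn.mono hκ hα Measure.restrict_le_self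
  have hβf : β univ ≠ ∞ := by rw [hβ, Measure.restrict_apply_univ]; exact hsf.ne
  rcases eq_or_ne (β univ) 0 with h0 | h0
  · rw [Measure.measure_univ_eq_zero.1 h0]
    simp [energy]
  have e1 := energy_lt_top hκ hE hβA.1 hν.1.1
  have e2 := energy_lt_top hκ hE hβA.1 hlam.1.1.1
  rw [← ENNReal.toReal_le_toReal (by finiteness) (by finiteness),
    ENNReal.toReal_add (by finiteness) (by finiteness),
    ENNReal.toReal_add (by finiteness) (by finiteness), ENNReal.toReal_mul, ENNReal.toReal_mul]
  change realEnergy κ β ν + p * _ ≤ realEnergy κ β lam + q * _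
  have h := hlam.weightedConstant_le hκ hE hω hν (normalize_mem hκ hβA h0 hβf)
  rw [realEnergy_smul_left hκ _ hν.1.1, realEnergy_smul_left hκ _ hlam.1.1.1, ← hpq,
    ← mul_sub] at h
  have hpos : 0 < (β univ).toReal := ENNReal.toReal_pos h0 hβf
  rw [NNReal.coe_inv, ENNReal.coe_toNNReal_eq_toReal, le_inv_mul_iff₀ hpos] at h
  linarith

end Topological

end Balayage

theorem mainTheorem5 {X : Type*} [TopologicalSpace X] [T2Space X] [LocallyCompactSpace X]
    [SecondCountableTopology X] [MeasurableSpace X] [BorelSpace X]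
    (κ : X × X → ℝ≥0∞) (hκ : Balayage.IsKernel κ)
    (henergy : Balayage.EnergyPrinciple κ)
    (hconsistency : Balayage.ConsistencyPrinciple κ)
    (hdomination : Balayage.DominationPrinciple κ)
    (hFrostman : Balayage.FrostmanPrinciple κ)
    (A : Set X) (hcap : 0 < Balayage.innerCapacity κ A)
    (hclosed : Balayage.StronglyClosed κ A)
    (ω : Measure X) (hω : Balayage.Admissible κ A ω) :
    ∃ ωA : Measure X,
      (Balayage.IsInnerBalayage κ A ω ωA ∧
        ∀ ν : Measure X, Balayage.IsInnerBalayage κ A ω ν → ν = ωA) ∧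
      ∀ lam : Measure X, Balayage.IsGaussMinimizer κ A ω lam →
        (∀ᵐ x ∂lam, Balayage.potential κ lam x < ∞ ∧ Balayage.potential κ ω x < ∞) ∧
        Integrable (Balayage.weightedPotential κ ω lam) lam ∧
        (1 < ωA univ → Balayage.weightedConstant κ ω lam < 0) ∧
        (ωA univ = 1 → Balayage.weightedConstant κ ω lam = 0) ∧
        (ωA univ < 1 → 0 < Balayage.weightedConstant κ ω lam) := by
  open Balayage in
  obtain ⟨C, hL⟩ := hω.exists_lipschitzField hκ henergy hconsistency hdomination hFrostman
  obtain ⟨ν, hνA, hνeq⟩ := hL.exists_balayage hκ henergy hconsistency hdomination hclosed hω.radon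
  have hν : IsInnerBalayage κ A ω ν := (isInnerBalayage_iff hκ hω.radon).2 ⟨hνA, hνeq⟩
  refine ⟨ν, ⟨hν, fun ν' hν' => hν'.unique hκ henergy hω.radon hν⟩, fun lam hlam => ?_⟩
  obtain ⟨h1, h2, hc⟩ := hν.integrable_weightedPotential hκ henergy hω.radon hlam.1.1
  refine ⟨h1, h2, fun hlt => ?_, fun heq => ?_, fun hlt => ?_⟩
  · by_contra! h0
    rw [hc] at h0
    refine hlt.not_ge ((measure_univ_le_of_potential_le hκ henergy hconsistency hFrostman hνA.1
      hlam.1.1.1.1 (hdomination ν hνA.1 lam hlam.1.1.1.1 ?_)).trans_eq hlam.1.2)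
    filter_upwards [hlam.ae_le hκ henergy hω.radon hν (p := ⟨_, h0⟩) (q := 0)
      (by rw [NNReal.coe_zero, sub_zero]; rfl) hνA]
      with x hx
    simp only [ENNReal.coe_zero, add_zero] at hx
    exact le_self_add.trans hx
  · have hmin := hlam.2 ν ⟨hνA, heq⟩
    rw [hν.gauss_eq hκ hω.radon hlam.1.1, hν.gauss_eq hκ hω.radon hνA] at hmin
    have h3 : lam = ν := eq_of_sqDist_nonpos hκ henergy hlam.1.1.1 hνA.1 (by
      have : sqDist κ ν ν = 0 := by rw [sqDist]; ring
      linarith)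
    rw [hc, h3, sub_self]
  · by_contra! h0
    rw [hc] at h0
    have hd : 0 ≤ realEnergy κ lam ν - realEnergy κ lam lam := by linarith
    have hle := hlam.ae_le hκ henergy hω.radon hν (p := 0) (q := ⟨_, hd⟩)
      (by rw [NNReal.coe_zero, zero_sub]; exact neg_sub _ _) hlam.1.1
    set d : ℝ≥0 := ⟨_, hd⟩
    simp only [ENNReal.coe_zero, add_zero] at hle
    have hfin := energy_lt_top hκ henergy hlam.1.1.1 hνA.1
    have hfin' := hlam.1.1.1.2
    have heq := ae_eq_of_ae_le_of_lintegral_le hle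
      (by rw [← energy_eq_lintegral hκ _ hνA.1.1]; exact hfin.ne)
      ((measurable_potential hκ hlam.1.1.1.1).add_const _).aemeasurable (by
        rw [lintegral_add_left (measurable_potential hκ hlam.1.1.1.1),
          ← energy_eq_lintegral hκ _ hνA.1.1, ← energy_eq_lintegral hκ _ hlam.1.1.1.1,
          lintegral_const, hlam.1.2, mul_one,
          ← ENNReal.toReal_le_toReal (by finiteness) hfin.ne,
          ENNReal.toReal_add (by finiteness) (by finiteness), ENNReal.coe_toReal]
        change realEnergy κ lam lam + (realEnergy κ lam ν - realEnergy κ lam lam)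
          ≤ realEnergy κ lam ν
        linarith)
    refine hlt.not_ge (hlam.1.2.symm.trans_le (measure_univ_le_of_potential_le hκ henergy
      hconsistency hFrostman hlam.1.1.1 hνA.1.1
      (hdomination lam hlam.1.1.1 ν hνA.1.1 ?_)))
    filter_upwards [heq] with x hx
    rw [hx]
    exact le_self_add
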